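/- Let $X$ and $Y$ be infinite locally compact Hausdorff spaces. Let $\beta$ denote the Stone–Čech compactification, with canonical maps $i^X : X \to \beta X$, $i^Y : Y \to \beta Y$ and $i^{X\times Y} : X\times Y \to \beta(X\times Y)$, and let $\phi : \beta(X\times Y) \to \beta X \times \beta Y$ be the natural map, that is, the unique continuous map with $\phi \circ i^{X\times Y} = i^X \times i^Y$. Then $\phi$ is a homeomorphism if and only if both $X$ and $Y$ are pseudocompact, where a space is called pseudocompact if every continuous real-valued function on it is bounded. -/

import Mathlib

/-- A topological space is pseudocompact if every continuous real-valued function on it is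
bounded. -/
def IsPseudocompact (X : Type*) [TopologicalSpace X] : Prop :=
  ∀ f : X → ℝ, Continuous f → ∃ C : ℝ, ∀ x : X, |f x| ≤ C

/-- The product `(x, y) ↦ (i x, i y)` of the canonical maps of `X` and `Y` into their
Stone-Čech compactifications is continuous. -/
theorem continuous_prodMap_stoneCechUnit (X Y : Type*) [TopologicalSpace X]
    [TopologicalSpace Y] :
    Continuous (Prod.map stoneCechUnit stoneCechUnit : X × Y → StoneCech X × StoneCech Y) :=
  continuous_stoneCechUnit.prodMap continuous_stoneCechUnit

/-- The natural map `β(X × Y) → βX × βY`: the unique continuous extension to `β(X × Y)` of the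
product of the canonical maps `X → βX` and `Y → βY`. -/
noncomputable def stoneCechProdMap (X Y : Type*) [TopologicalSpace X] [TopologicalSpace Y] :
    StoneCech (X × Y) → StoneCech X × StoneCech Y :=
  stoneCechExtend (continuous_prodMap_stoneCechUnit X Y)

/-!
The natural map is a bijection exactly when every continuous `[0, 1]`-valued function on `X × Y`
extends to `βX × βY`.

If `X` is not pseudocompact, it carries a locally finite sequence of bump functions `bₙ` with
`bₙ(xₘ) = δₙₘ`, and the infinite Tychonoff space `Y` carries functions `gₙ` with `gₙ(yₘ) = δₙₘ`. The
function `∑ bₙ(x) gₙ(y)` takes the values `δₙₘ` at `(xₙ, yₘ)`, so it cannot extend: along an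
ultrafilter the iterated limit would be `0` and the diagonal limit `1`.

Conversely, a continuous map from a pseudocompact space to a complete metric space has totally
bounded range, hence extends to the Stone-Čech compactification. By the exponential law this applies
first to the map `Y → C(K, [0, 1])` for each compact `K ⊆ X`, extending the function to `X × βY`
because `X` is locally compact, and then to the resulting map `X → C(βY, [0, 1])`.
-/

open Set Filter Topology

section StoneCechExtend

variable {Z K : Type*} [TopologicalSpace Z] [TopologicalSpace K] {i : Z → K}

/-- The property that `Z` is `C*`-embedded in `K` along `i`: every bounded continuous real function
on `Z` extends to `K`. By rescaling it is enough to consider functions with values in `[0, 1]`;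
`i` itself is not required to be an embedding. -/
def IsCStarEmbedded (i : Z → K) : Prop :=
  ∀ f : C(Z, unitInterval), ∃ g : C(K, unitInterval), ∀ z, g (i z) = f z

variable [CompactSpace K] [T2Space K]

theorem surjective_stoneCechExtend (hi : Continuous i) (hd : DenseRange i) :
    Function.Surjective (stoneCechExtend hi) := by
  have h_range : range i ⊆ range (stoneCechExtend hi) :=
    range_subset_iff.2 fun z ↦ ⟨stoneCechUnit z, stoneCechExtend_stoneCechUnit hi z⟩
  have h_closed : IsClosed (range (stoneCechExtend hi)) :=
    (isCompact_range (continuous_stoneCechExtend hi)).isClosed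
  rw [← range_eq_univ, ← h_closed.closure_eq, (hd.mono h_range).closure_eq]

theorem injective_stoneCechExtend_iff (hi : Continuous i) :
    Function.Injective (stoneCechExtend hi) ↔ IsCStarEmbedded i := by
  constructor
  · intro h_inj f
    obtain ⟨g, hg⟩ := ContinuousMap.exists_extension'
      ((continuous_stoneCechExtend hi).isClosedEmbedding h_inj)
      ⟨stoneCechExtend f.continuous, continuous_stoneCechExtend _⟩
    refine ⟨g, fun z ↦ ?_⟩
    simpa only [Function.comp_apply, ContinuousMap.coe_mk, stoneCechExtend_stoneCechUnit]
      using congrFun hg (stoneCechUnit z)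
  · intro h a b hab
    by_contra hne
    obtain ⟨u, hu, hua, hub⟩ :=
      CompletelyRegularSpace.completely_regular a {b} isClosed_singleton hne
    obtain ⟨g, hg⟩ := h ⟨u ∘ stoneCechUnit, hu.comp continuous_stoneCechUnit⟩
    have h_factor : g ∘ stoneCechExtend hi = u := by
      refine stoneCech_hom_ext (g.continuous.comp (continuous_stoneCechExtend hi)) hu ?_
      ext z
      simp only [Function.comp_apply, stoneCechExtend_stoneCechUnit, hg, ContinuousMap.coe_mk]
    have hu_eq : u a = u b := by
      simp only [← h_factor, Function.comp_apply, hab]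
    exact zero_ne_one (hua.symm.trans (hu_eq.trans (hub rfl)))

theorem isHomeomorph_stoneCechExtend_iff (hi : Continuous i) (hd : DenseRange i) :
    IsHomeomorph (stoneCechExtend hi) ↔ IsCStarEmbedded i := by
  rw [isHomeomorph_iff_continuous_bijective, ← injective_stoneCechExtend_iff hi]
  exact ⟨fun h ↦ h.2.1,
    fun h ↦ ⟨continuous_stoneCechExtend hi, h, surjective_stoneCechExtend hi hd⟩⟩

end StoneCechExtend

theorem IsCStarEmbedded.prodMap_swap {X Y K L : Type*} [TopologicalSpace X] [TopologicalSpace Y]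
    [TopologicalSpace K] [TopologicalSpace L] {i : X → K} {j : Y → L}
    (h : IsCStarEmbedded (Prod.map i j)) : IsCStarEmbedded (Prod.map j i) := fun f ↦ by
  obtain ⟨g, hg⟩ := h (f.comp .prodSwap)
  exact ⟨g.comp .prodSwap, fun p ↦ hg p.swap⟩

section SeparatedSequences

variable {M : Type*} [PseudoMetricSpace M]

theorem exists_seq_pairwise_le_dist_of_not_totallyBounded {s : Set M} (hs : ¬ TotallyBounded s) :
    ∃ ε > 0, ∃ z : ℕ → M, (∀ n, z n ∈ s) ∧ Pairwise fun n m ↦ ε ≤ dist (z n) (z m) := by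
  rw [Metric.totallyBounded_iff] at hs
  push Not at hs
  obtain ⟨ε, hε, h_cover⟩ := hs
  have : Std.Symm fun a b : M ↦ ε ≤ dist a b := ⟨fun a b h ↦ by rwa [dist_comm]⟩
  obtain ⟨z, hzs, hz⟩ := exists_seq_of_forall_finset_exists' (· ∈ s) (fun a b ↦ ε ≤ dist a b)
    fun t _ ↦ by
      obtain ⟨c, hcs, hc⟩ := not_subset.1 (h_cover t t.finite_toSet)
      simp only [mem_iUnion, Metric.mem_ball', not_exists, not_lt] at hc
      exact ⟨c, hcs, hc⟩
  exact ⟨ε, hε, z, hzs, hz⟩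

theorem locallyFinite_ball_of_pairwise_le_dist {ι : Type*} {z : ι → M} {ε : ℝ} (hε : 0 < ε)
    (hz : Pairwise fun i j ↦ ε ≤ dist (z i) (z j)) :
    LocallyFinite fun i ↦ Metric.ball (z i) (ε / 4) := by
  intro p
  refine ⟨Metric.ball p (ε / 4), Metric.ball_mem_nhds p (by positivity), ?_⟩
  refine Set.Subsingleton.finite ?_
  rintro i ⟨q, hqi, hqp⟩ j ⟨r, hrj, hrp⟩
  by_contra hij
  rw [Metric.mem_ball] at hqp hrj
  rw [Metric.mem_ball'] at hqi hrp
  have h_path : dist (z i) (z j) ≤ dist (z i) q + dist q p + (dist p r + dist r (z j)) :=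
    (dist_triangle _ p _).trans (add_le_add (dist_triangle _ _ _) (dist_triangle _ _ _))
  linarith [hz hij]

end SeparatedSequences

section Biorthogonal

variable {X Y : Type*} [TopologicalSpace X] [TopologicalSpace Y]

/-- A sequence of points and a sequence of continuous functions are biorthogonal if `bₙ(xₘ) = δₙₘ`.
For locally finite `b`, this is the standard witness that `X` is not pseudocompact. -/
def IsBiorthogonal (x : ℕ → X) (b : ℕ → C(X, ℝ)) : Prop :=
  ∀ n m, b n (x m) = if n = m then 1 else 0

theorem IsBiorthogonal.finsum_mul {x : ℕ → X} {b : ℕ → C(X, ℝ)} (hb : IsBiorthogonal x b)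
    (c : ℕ → ℝ) (m : ℕ) : ∑ᶠ n, b n (x m) * c n = c m := by
  rw [finsum_eq_single _ m fun n hn ↦ by rw [hb, if_neg hn, zero_mul], hb, if_pos rfl, one_mul]

theorem IsBiorthogonal.not_isPseudocompact {x : ℕ → X} {b : ℕ → C(X, ℝ)}
    (hb : IsBiorthogonal x b) (h_fin : LocallyFinite fun n ↦ Function.support (b n)) :
    ¬ IsPseudocompact X := by
  intro hX
  obtain ⟨C, hC⟩ := hX (fun a ↦ ∑ᶠ n, b n a * (n : ℝ)) <|
    continuous_finsum (fun n ↦ by fun_prop)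
      (h_fin.subset fun _ ↦ Function.support_mul_subset_left _ _)
  obtain ⟨N, hN⟩ := exists_nat_gt C
  have h_le : |(N : ℝ)| ≤ C := by simpa only [hb.finsum_mul] using hC (x N)
  exact (hN.trans_le (le_abs_self _)).not_ge h_le

theorem exists_isBiorthogonal_of_not_totallyBounded_range {M : Type*} [PseudoMetricSpace M]
    {F : X → M} (hF : Continuous F) (h : ¬ TotallyBounded (range F)) :
    ∃ (x : ℕ → X) (b : ℕ → C(X, ℝ)),
      IsBiorthogonal x b ∧ LocallyFinite fun n ↦ Function.support (b n) := by
  obtain ⟨ε, hε, z, hz_range, hz⟩ := exists_seq_pairwise_le_dist_of_not_totallyBounded h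
  choose x hx using hz_range
  have hε4 : 0 < ε / 4 := by positivity
  let b : ℕ → C(X, ℝ) := fun n ↦ ⟨fun a ↦ thickenedIndicator hε4 {z n} (F a), by fun_prop⟩
  have hb_zero : ∀ n a, F a ∉ Metric.ball (z n) (ε / 4) → b n a = 0 := fun n a ha ↦ by
    rw [← Metric.thickening_singleton] at ha
    exact congrArg NNReal.toReal (thickenedIndicator_zero hε4 _ ha)
  refine ⟨x, b, fun n m ↦ ?_, ?_⟩
  · split_ifs with hnm
    · subst hnm
      exact congrArg NNReal.toReal (thickenedIndicator_one hε4 {z n} (mem_singleton_iff.2 (hx n)))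
    · refine hb_zero n (x m) ?_
      rw [hx, Metric.mem_ball', not_lt]
      linarith [hz hnm]
  · refine ((locallyFinite_ball_of_pairwise_le_dist hε hz).preimage_continuous hF).subset ?_
    exact fun n a ha ↦ not_imp_comm.1 (hb_zero n a) ha

theorem exists_isBiorthogonal_of_not_isPseudocompact (h : ¬ IsPseudocompact X) :
    ∃ (x : ℕ → X) (b : ℕ → C(X, ℝ)),
      IsBiorthogonal x b ∧ LocallyFinite fun n ↦ Function.support (b n) := by
  unfold IsPseudocompact at h
  push Not at h
  obtain ⟨u, hu, h_unbdd⟩ := h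
  refine exists_isBiorthogonal_of_not_totallyBounded_range hu fun h_tb ↦ ?_
  obtain ⟨C, hC⟩ := h_tb.isBounded.exists_norm_le
  obtain ⟨a, ha⟩ := h_unbdd C
  exact ha.not_ge (hC (u a) (mem_range_self a))

theorem exists_isBiorthogonal (Y : Type*) [TopologicalSpace Y] [T35Space Y] [Infinite Y] :
    ∃ (y : ℕ → Y) (g : ℕ → C(Y, ℝ)), IsBiorthogonal y g := by
  obtain ⟨y, hy⟩ := exists_topology_isEmbedding_nat Y
  have h_bump : ∀ n, ∃ g : C(Y, ℝ), ∀ m, g (y m) = if n = m then 1 else 0 := by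
    intro n
    obtain ⟨U, hU, hUn⟩ := hy.isOpen_iff.1 (isOpen_discrete {n})
    have h_mem : ∀ m, y m ∈ U ↔ m = n := fun m ↦ by
      rw [← mem_preimage, hUn, mem_singleton_iff]
    obtain ⟨u, hu, hu_zero, hu_one⟩ := CompletelyRegularSpace.completely_regular (y n) Uᶜ
      hU.isClosed_compl (not_not.2 ((h_mem n).2 rfl))
    refine ⟨⟨fun a ↦ 1 - (u a : ℝ), by fun_prop⟩, fun m ↦ ?_⟩
    split_ifs with hnm
    · subst hnm
      simp [hu_zero]
    · have : y m ∈ Uᶜ := fun hm ↦ hnm ((h_mem m).1 hm).symm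
      simp [hu_one this]
  choose g hg using h_bump
  exact ⟨y, g, hg⟩

theorem exists_continuousMap_prod_eq_ite [T35Space Y] [Infinite Y] (h : ¬ IsPseudocompact X) :
    ∃ (x : ℕ → X) (y : ℕ → Y) (f : C(X × Y, ℝ)), ∀ n m, f (x n, y m) = if n = m then 1 else 0 := by
  obtain ⟨x, b, hb, hb_fin⟩ := exists_isBiorthogonal_of_not_isPseudocompact h
  obtain ⟨y, g, hg⟩ := exists_isBiorthogonal Y
  have h_fin : LocallyFinite fun n ↦ Function.support fun p : X × Y ↦ b n p.1 * g n p.2 :=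
    (hb_fin.preimage_continuous continuous_fst).subset
      fun _ ↦ Function.support_mul_subset_left _ _
  refine ⟨x, y, ⟨fun p ↦ ∑ᶠ n, b n p.1 * g n p.2,
    continuous_finsum (fun n ↦ by fun_prop) h_fin⟩, fun n m ↦ ?_⟩
  exact (hb.finsum_mul (fun k ↦ g k (y m)) n).trans (hg n m)

end Biorthogonal

theorem eq_of_forall_offDiag_of_forall_diag {ι K L Z : Type*} [Infinite ι] [TopologicalSpace K]
    [TopologicalSpace L] [TopologicalSpace Z] [CompactSpace K] [CompactSpace L] [T2Space Z]
    {g : K × L → Z} (hg : Continuous g) {a : ι → K} {b : ι → L} {c d : Z}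
    (h_off : ∀ i j, i ≠ j → g (a i, b j) = c) (h_diag : ∀ i, g (a i, b i) = d) : c = d := by
  let U : Ultrafilter ι := hyperfilter ι
  obtain ⟨a', ha⟩ : ∃ a', Tendsto a U (𝓝 a') := ⟨_, (U.map a).le_nhds_lim⟩
  obtain ⟨b', hb⟩ : ∃ b', Tendsto b U (𝓝 b') := ⟨_, (U.map b).le_nhds_lim⟩
  have h_row : ∀ i, g (a i, b') = c := fun i ↦ by
    refine tendsto_nhds_unique ((hg.tendsto _).comp (tendsto_const_nhds.prodMk_nhds hb)) ?_
    have h_ne : ∀ᶠ j in (U : Filter ι), j ≠ i := hyperfilter_le_cofinite (by simp)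
    exact tendsto_const_nhds.congr' (h_ne.mono fun j hj ↦ (h_off i j hj.symm).symm)
  have h_iterated : g (a', b') = c :=
    tendsto_nhds_unique ((hg.tendsto _).comp (ha.prodMk_nhds tendsto_const_nhds))
      (tendsto_const_nhds.congr fun i ↦ (h_row i).symm)
  have h_diagonal : g (a', b') = d :=
    tendsto_nhds_unique ((hg.tendsto _).comp (ha.prodMk_nhds hb))
      (tendsto_const_nhds.congr fun i ↦ (h_diag i).symm)
  exact h_iterated.symm.trans h_diagonal

theorem IsCStarEmbedded.isPseudocompact_of_prodMap {X Y K L : Type*} [TopologicalSpace X]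
    [TopologicalSpace Y] [TopologicalSpace K] [TopologicalSpace L] [CompactSpace K] [CompactSpace L]
    [T35Space Y] [Infinite Y] {i : X → K} {j : Y → L} (h : IsCStarEmbedded (Prod.map i j)) :
    IsPseudocompact X := by
  by_contra hX
  obtain ⟨x, y, f, hf⟩ := exists_continuousMap_prod_eq_ite (Y := Y) hX
  obtain ⟨g, hg⟩ := h ⟨fun p ↦ projIcc 0 1 zero_le_one (f p), by fun_prop⟩
  have hg_apply : ∀ n m, g (i (x n), j (y m)) = projIcc 0 1 zero_le_one (f (x n, y m)) :=
    fun n m ↦ hg (x n, y m)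
  refine zero_ne_one (α := unitInterval) <| eq_of_forall_offDiag_of_forall_diag g.continuous
    (a := fun n ↦ i (x n)) (b := fun m ↦ j (y m)) (fun n m hnm ↦ ?_) fun n ↦ ?_
  · rw [hg_apply, hf, if_neg hnm, projIcc_left, Icc.mk_zero]
  · rw [hg_apply, hf, if_pos rfl, projIcc_right, Icc.mk_one]

section Extension

variable {X Y M : Type*} [TopologicalSpace X] [TopologicalSpace Y]

theorem IsPseudocompact.totallyBounded_range [PseudoMetricSpace M] (hX : IsPseudocompact X)
    {F : X → M} (hF : Continuous F) : TotallyBounded (range F) := by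
  by_contra h
  obtain ⟨x, b, hb, hb_fin⟩ := exists_isBiorthogonal_of_not_totallyBounded_range hF h
  exact hb.not_isPseudocompact hb_fin hX

variable [MetricSpace M] [CompleteSpace M]

theorem IsPseudocompact.exists_extension_stoneCech (hX : IsPseudocompact X) (f : C(X, M)) :
    ∃ g : C(StoneCech X, M), ∀ x, g (stoneCechUnit x) = f x := by
  have h_compact : IsCompact (closure (range f)) :=
    (hX.totallyBounded_range f.continuous).closure.isCompact_of_isClosed isClosed_closure
  have : CompactSpace (closure (range f)) := isCompact_iff_compactSpace.1 h_compact
  have hf : Continuous fun x ↦ (⟨f x, subset_closure (mem_range_self x)⟩ : closure (range f)) :=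
    f.continuous.subtype_mk _
  have hg : Continuous fun z ↦ (stoneCechExtend hf z).1 :=
    continuous_subtype_val.comp (continuous_stoneCechExtend hf)
  exact ⟨⟨_, hg⟩, fun x ↦ congrArg Subtype.val (stoneCechExtend_stoneCechUnit hf x)⟩

theorem IsPseudocompact.exists_curry_extension_of_compactSpace [CompactSpace X]
    (hY : IsPseudocompact Y) (f : C(X × Y, M)) :
    ∃ G : C(X, C(StoneCech Y, M)), ∀ x y, G x (stoneCechUnit y) = f (x, y) := by
  obtain ⟨H, hH⟩ := hY.exists_extension_stoneCech (f.comp .prodSwap).curry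
  let h : C(X × StoneCech Y, M) := ⟨fun p ↦ H p.2 p.1, by fun_prop⟩
  exact ⟨h.curry, fun x y ↦ DFunLike.congr_fun (hH y) x⟩

theorem IsPseudocompact.exists_curry_extension [WeaklyLocallyCompactSpace X]
    (hY : IsPseudocompact Y) (f : C(X × Y, M)) :
    ∃ G : C(X, C(StoneCech Y, M)), ∀ x y, G x (stoneCechUnit y) = f (x, y) := by
  choose G hG using fun x ↦ hY.exists_extension_stoneCech (f.curry x)
  refine ⟨⟨G, continuous_iff_continuousAt.2 fun x₀ ↦ ?_⟩, hG⟩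
  obtain ⟨K, hK, hKx₀⟩ := exists_compact_mem_nhds x₀
  have : CompactSpace K := isCompact_iff_compactSpace.1 hK
  obtain ⟨H, hH⟩ := hY.exists_curry_extension_of_compactSpace
    (f.comp (ContinuousMap.prodMap ⟨((↑) : K → X), continuous_subtype_val⟩ (.id Y)))
  have h_domRestrict : K.domRestrict G = H := by
    ext1 k
    refine DFunLike.coe_injective (stoneCech_hom_ext (G k).continuous (H k).continuous ?_)
    ext y
    exact (hG k y).trans (hH k y).symm
  have h_on : ContinuousOn G K := by
    rw [continuousOn_iff_continuous_domRestrict, h_domRestrict]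
    exact H.continuous
  exact h_on.continuousAt hKx₀

theorem IsPseudocompact.exists_extension_prod [WeaklyLocallyCompactSpace X]
    (hX : IsPseudocompact X) (hY : IsPseudocompact Y) (f : C(X × Y, M)) :
    ∃ g : C(StoneCech X × StoneCech Y, M),
      ∀ x y, g (stoneCechUnit x, stoneCechUnit y) = f (x, y) := by
  obtain ⟨G, hG⟩ := hY.exists_curry_extension f
  obtain ⟨H, hH⟩ := hX.exists_extension_stoneCech G
  exact ⟨H.uncurry, fun x y ↦ (DFunLike.congr_fun (hH x) _).trans (hG x y)⟩

end Extension

theorem t35Space_of_t2Space_of_weaklyLocallyCompactSpace (X : Type*) [TopologicalSpace X]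
    [T2Space X] [WeaklyLocallyCompactSpace X] : T35Space X where
  toT0Space := inferInstance
  toCompletelyRegularSpace :=
    OnePoint.isOpenEmbedding_coe.isInducing.completelyRegularSpace

theorem theorem4_general {X Y : Type*} [TopologicalSpace X] [TopologicalSpace Y]
    [T35Space X] [T35Space Y] [WeaklyLocallyCompactSpace X] [Infinite X] [Infinite Y] :
    IsHomeomorph (stoneCechProdMap X Y) ↔ IsPseudocompact X ∧ IsPseudocompact Y := by
  have h_dense : DenseRange (Prod.map stoneCechUnit stoneCechUnit :
      X × Y → StoneCech X × StoneCech Y) :=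
    denseRange_stoneCechUnit.prodMap denseRange_stoneCechUnit
  rw [stoneCechProdMap, isHomeomorph_stoneCechExtend_iff _ h_dense]
  constructor
  · intro h
    exact ⟨h.isPseudocompact_of_prodMap, h.prodMap_swap.isPseudocompact_of_prodMap⟩
  · rintro ⟨hX, hY⟩ f
    obtain ⟨g, hg⟩ := hX.exists_extension_prod hY f
    exact ⟨g, fun p ↦ hg p.1 p.2⟩

theorem theorem4 {X Y : Type*} [TopologicalSpace X] [TopologicalSpace Y]
    [T2Space X] [T2Space Y] [LocallyCompactSpace X] [LocallyCompactSpace Y]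
    [Infinite X] [Infinite Y] :
    IsHomeomorph (stoneCechProdMap X Y) ↔ IsPseudocompact X ∧ IsPseudocompact Y := by
  have := t35Space_of_t2Space_of_weaklyLocallyCompactSpace X
  have := t35Space_of_t2Space_of_weaklyLocallyCompactSpace Y
  exact theorem4_general
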